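/- Let $q=5^d$ with $d\ge 1$, and let $\mathbb{F}_q$ be the finite field of order $q$. Let $m_q$ (respectively $n_q$) be the number of quadruples $\{\alpha-1,\alpha,\alpha+1,\alpha+2\}$, $\alpha\in\mathbb{F}_q$, of consecutive elements of $\mathbb{F}_q$ that are all non-zero squares (respectively all non-squares) in $\mathbb{F}_q$, the quadruples being counted by $\alpha$. There is a unique integer $s$ with $s\equiv 1 \pmod 4$ and $5\nmid s$ such that $q=s^2+t^2$ for some integer $t$. With this $s$, if $d$ is even, then $$m_q=\frac{q-10s-39}{16},\qquad n_q=\frac{q+6s-7}{16},$$ and if $d$ is odd, then $$m_q=n_q=\frac{q+2s-7}{16}.$$ -/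

import Mathlib

/-- The quadruple of consecutive elements `α - 1, α, α + 1, α + 2`. -/
def consecutiveQuadruple {F : Type*} [Field F] (α : F) : Set F :=
  {α - 1, α, α + 1, α + 2}

/-- `m_q`: the number of quadruples of consecutive elements all of which are non-zero squares,
each quadruple being given by its element `α`. -/
noncomputable def squareQuadrupleCount (F : Type*) [Field F] : ℕ :=
  Set.ncard {α : F | ∀ x ∈ consecutiveQuadruple α, x ≠ 0 ∧ IsSquare x}

/-- `n_q`: the number of quadruples of consecutive elements all of which are non-squares
(zero is a square, so these elements are automatically non-zero). -/
noncomputable def nonsquareQuadrupleCount (F : Type*) [Field F] : ℕ :=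
  Set.ncard {α : F | ∀ x ∈ consecutiveQuadruple α, ¬ IsSquare x}

/-- The integers `s`, `t` satisfy `q = s² + t²`, `p ∤ s` and `s ≡ 1 (mod 4)`. -/
def IsNormalizedTwoSquares (p q : ℕ) (s t : ℤ) : Prop :=
  (q : ℤ) = s ^ 2 + t ^ 2 ∧ ¬ (p : ℤ) ∣ s ∧ s ≡ 1 [ZMOD 4]

/-! Write χ for the quadratic character. Off its zeros, the product of the four factors 1 + εχ is 16
times the indicator of a good quadruple, so the counts reduce to character sums
(`sixteen_mul_card_eq`). Linear sums vanish and pair sums are -1. In characteristic 5, affine maps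
turn every cubic sum into a multiple of S = `jacobsthalSum (-1)`, and inversion reduces the quartic
sum to S as well (`sum_quadrupleWeight`). Only S and χ(2) = (-1)^d remain.

S is twice the normalized s up to sign: Jacobsthal's identity gives the two squares, the Hasse
invariant shows 5 ∤ S, and a congruence mod 8 fixes the sign
(`exists_isNormalizedTwoSquares_jacobsthalSum`). Uniqueness of s is an independent divisibility
argument. -/

open Finset

/-! ### Quadratic character sums and Jacobsthal's identity. -/

section QuadraticCharacterSums

variable {F : Type*} [Field F] [Fintype F]

theorem sum_comp_affine {M : Type*} [AddCommMonoid M] (f : F → M) {u : F} (hu : u ≠ 0) (v : F) :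
    ∑ x, f (u * x + v) = ∑ x, f x :=
  ((Equiv.mulLeft₀ u hu).trans (Equiv.addRight v)).sum_comp f

variable [DecidableEq F]

theorem quadraticChar_mul_self {a : F} (ha : a ≠ 0) :
    quadraticChar F a * quadraticChar F a = 1 := by
  rw [← sq, quadraticChar_sq_one ha]

/-- An affine substitution yields χ(-1) times the Jacobi sum J(χ, χ⁻¹) = -χ(-1). -/
theorem sum_quadraticChar_mul_add {u v : F} (hF : ringChar F ≠ 2) (huv : u ≠ v) :
    ∑ a, quadraticChar F (a + u) * quadraticChar F (a + v) = -1 := by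
  have hJ := jacobiSum_nontrivial_inv (quadraticChar_ne_one hF)
  rw [(quadraticChar_isQuadratic F).inv] at hJ
  have hd : u - v ≠ 0 := sub_ne_zero.mpr huv
  have h1 := quadraticChar_mul_self hd
  have h2 := quadraticChar_mul_self (neg_ne_zero.mpr (one_ne_zero (α := F)))
  rw [← sum_comp_affine _ hd (-u)]
  have : ∀ x : F, quadraticChar F ((u - v) * x + -u + u) * quadraticChar F ((u - v) * x + -u + v)
      = quadraticChar F (-1) * (quadraticChar F x * quadraticChar F (1 - x)) := by
    intro x
    have e1 : (u - v) * x + -u + u = (u - v) * x := by ring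
    have e2 : (u - v) * x + -u + v = (u - v) * (-1 * (1 - x)) := by ring
    rw [e1, e2]
    simp only [map_mul]
    linear_combination (quadraticChar F x * quadraticChar F (-1) * quadraticChar F (1 - x)) * h1
  rw [sum_congr rfl fun x _ => this x, ← mul_sum]
  have : ∑ x, quadraticChar F x * quadraticChar F (1 - x) = - quadraticChar F (-1) := hJ
  rw [this]
  linear_combination -h2

/-- The sum of the quadratic character over the values of `x (x ^ 2 + a)`. -/
def jacobsthalSum (a : F) : ℤ := ∑ x, quadraticChar F x * quadraticChar F (x ^ 2 + a)

theorem jacobsthalSum_sq_mul {c : F} (hc : c ≠ 0) (a : F) :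
    jacobsthalSum (c ^ 2 * a) = quadraticChar F c * jacobsthalSum a := by
  unfold jacobsthalSum
  rw [← sum_comp_affine _ hc 0, mul_sum]
  refine sum_congr rfl fun x _ => ?_
  have e : (c * x + 0) ^ 2 + c ^ 2 * a = c ^ 2 * (x ^ 2 + a) := by ring
  rw [e, add_zero, map_mul, map_mul, quadraticChar_sq_one' hc]
  ring

theorem jacobsthalSum_zero (hF : ringChar F ≠ 2) : jacobsthalSum (0 : F) = 0 := by
  rw [jacobsthalSum, ← quadraticChar_sum_zero hF]
  refine sum_congr rfl fun x _ => ?_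
  by_cases hx : x = 0
  · simp [hx]
  · rw [add_zero, quadraticChar_sq_one' hx, mul_one]

/-- Expand the square and sum over a first: the inner sum is -1, plus q exactly when y = ±x. Both
signs contribute equally because χ(-1) = 1. -/
theorem sum_jacobsthalSum_sq (hF : ringChar F ≠ 2) (hneg : quadraticChar F (-1) = 1) :
    ∑ a : F, jacobsthalSum a ^ 2 = 2 * Fintype.card F * (Fintype.card F - 1) := by
  have hsq : ∀ a : F, jacobsthalSum a ^ 2 = ∑ x, ∑ y, quadraticChar F x * quadraticChar F y *
      (quadraticChar F (a + x ^ 2) * quadraticChar F (a + y ^ 2)) := by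
    intro a
    rw [sq, jacobsthalSum, sum_mul_sum]
    refine sum_congr rfl fun x _ => sum_congr rfl fun y _ => ?_
    rw [add_comm a, add_comm a]
    ring
  have hinner : ∀ x y : F, ∑ a, quadraticChar F (a + x ^ 2) * quadraticChar F (a + y ^ 2) =
      (if x ^ 2 = y ^ 2 then (Fintype.card F : ℤ) else 0) - 1 := by
    intro x y
    split_ifs with h
    · rw [h]
      have : ∀ a : F, quadraticChar F (a + y ^ 2) * quadraticChar F (a + y ^ 2) =
          1 - if a = - y ^ 2 then 1 else 0 := by
        intro a
        split_ifs with ha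
        · simp [ha]
        · rw [quadraticChar_mul_self (fun h => ha (eq_neg_of_add_eq_zero_left h)), sub_zero]
      rw [sum_congr rfl fun a _ => this a]
      simp [sum_sub_distrib]
    · rw [sum_quadraticChar_mul_add hF h, zero_sub]
  have hpair : ∀ x : F, ∑ y, quadraticChar F x * quadraticChar F y *
      (if x ^ 2 = y ^ 2 then (Fintype.card F : ℤ) else 0) =
      2 * Fintype.card F * (1 - if x = 0 then 1 else 0) := by
    intro x
    by_cases hx : x = 0
    · simp [hx]
    have h2 : (2 : F) ≠ 0 := Ring.two_ne_zero hF
    have hne : x ≠ -x := fun h => hx (by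
      have : 2 * x = 0 := by linear_combination h
      exact (mul_eq_zero.mp this).resolve_left h2)
    have hnegx : quadraticChar F (-x) = quadraticChar F x := by
      rw [← neg_one_mul, map_mul, hneg, one_mul]
    have hfil : (univ.filter fun y : F => x ^ 2 = y ^ 2) = {x, -x} := by
      ext y
      simp only [mem_filter, mem_univ, true_and, mem_insert, mem_singleton]
      rw [eq_comm, sq_eq_sq_iff_eq_or_eq_neg]
    simp only [mul_ite, mul_zero]
    rw [← sum_filter, hfil, sum_pair hne, hnegx]
    simp only [hx, if_false]
    linear_combination (2 * (Fintype.card F : ℤ)) * quadraticChar_mul_self hx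
  calc ∑ a : F, jacobsthalSum a ^ 2
      = ∑ x, ∑ y, ∑ a, quadraticChar F x * quadraticChar F y *
          (quadraticChar F (a + x ^ 2) * quadraticChar F (a + y ^ 2)) := by
        simp_rw [hsq]
        rw [sum_comm]
        exact sum_congr rfl fun x _ => sum_comm
    _ = ∑ x : F, ((∑ y, quadraticChar F x * quadraticChar F y *
          (if x ^ 2 = y ^ 2 then (Fintype.card F : ℤ) else 0)) -
          quadraticChar F x * ∑ y, quadraticChar F y) := by
        refine sum_congr rfl fun x _ => ?_
        rw [mul_sum, ← sum_sub_distrib]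
        refine sum_congr rfl fun y _ => ?_
        rw [← mul_sum, hinner]
        ring
    _ = _ := by
        simp_rw [hpair, quadraticChar_sum_zero hF]
        simp [← mul_sum, sum_sub_distrib]

theorem jacobsthalSum_sq_eq_of_quadraticChar_eq {a b : F} (hab : a ≠ 0) (hb : b ≠ 0)
    (h : quadraticChar F a = quadraticChar F b) : jacobsthalSum a ^ 2 = jacobsthalSum b ^ 2 := by
  have h1 : quadraticChar F (a / b) = 1 := by
    have h2 := quadraticChar_mul_self hb
    have h3 : quadraticChar F a = quadraticChar F (a / b) * quadraticChar F b := by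
      rw [← map_mul, div_mul_cancel₀ _ hb]
    linear_combination (quadraticChar F (a / b) - 1) * (-h2) - quadraticChar F b * h3 +
      quadraticChar F b * h
  obtain ⟨c, hc⟩ := (quadraticChar_one_iff_isSquare (div_ne_zero hab hb)).mp h1
  have hc0 : c ≠ 0 := by
    rintro rfl
    exact div_ne_zero hab hb (by simpa using hc)
  have e : a = c ^ 2 * b := by rw [sq, ← hc, div_mul_cancel₀ _ hb]
  rw [e, jacobsthalSum_sq_mul hc0, mul_pow, quadraticChar_sq_one hc0, one_mul]

/-- Jacobsthal's identity, which writes `4 q` as a sum of two squares. -/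
theorem jacobsthalSum_sq_add_sq (hF : ringChar F ≠ 2) (hneg : quadraticChar F (-1) = 1) {a b : F}
    (ha : quadraticChar F a = 1) (hb : quadraticChar F b = -1) :
    jacobsthalSum a ^ 2 + jacobsthalSum b ^ 2 = 4 * Fintype.card F := by
  have ha0 : a ≠ 0 := by rintro rfl; simp at ha
  have hb0 : b ≠ 0 := by rintro rfl; simp at hb
  -- The squared sum depends only on χ(x), so it is linear in χ(x) for x ≠ 0; the χ term cancels on
  -- summation.
  have key : ∀ x : F, 2 * jacobsthalSum x ^ 2 =
      (jacobsthalSum a ^ 2 + jacobsthalSum b ^ 2) * (1 - if x = 0 then 1 else 0) +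
      (jacobsthalSum a ^ 2 - jacobsthalSum b ^ 2) * quadraticChar F x := by
    intro x
    by_cases hx : x = 0
    · simp [hx, jacobsthalSum_zero hF]
    simp only [hx, if_false]
    rcases quadraticChar_dichotomy hx with h | h
    · rw [jacobsthalSum_sq_eq_of_quadraticChar_eq hx ha0 (h.trans ha.symm), h]; ring
    · rw [jacobsthalSum_sq_eq_of_quadraticChar_eq hx hb0 (h.trans hb.symm), h]; ring
  have hsum : ∑ x : F, 2 * jacobsthalSum x ^ 2 =
      (jacobsthalSum a ^ 2 + jacobsthalSum b ^ 2) * (Fintype.card F - 1) := by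
    rw [sum_congr rfl fun x _ => key x, sum_add_distrib, ← mul_sum, ← mul_sum,
      quadraticChar_sum_zero hF, mul_zero, add_zero]
    simp [sum_sub_distrib]
  rw [← mul_sum, sum_jacobsthalSum_sq hF hneg] at hsum
  have hq : (Fintype.card F : ℤ) - 1 ≠ 0 := by
    have := Fintype.one_lt_card (α := F)
    omega
  apply mul_right_cancel₀ hq
  linear_combination -hsum

end QuadraticCharacterSums

/-! ### Reduction of Jacobsthal sums modulo 5. -/

section PowerSums

/-- In base 5 every digit of k = (5^d - 1)/4 is 1 and every digit of 2k is 2, so Lucas gives a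
binomial congruent to 2^d. -/
theorem exists_five_pow_eq_and_not_dvd_centralBinom (d : ℕ) :
    ∃ k, 5 ^ d = 4 * k + 1 ∧ ¬ 5 ∣ (2 * k).choose k := by
  have : Fact (Nat.Prime 5) := ⟨by norm_num⟩
  induction d with
  | zero => exact ⟨0, by norm_num, by norm_num⟩
  | succ d ih =>
    obtain ⟨k, hk, h⟩ := ih
    refine ⟨5 * k + 1, by rw [pow_succ, hk]; ring, ?_⟩
    have hL := Choose.choose_modEq_choose_mod_mul_choose_div_nat (n := 2 * (5 * k + 1))
      (k := 5 * k + 1) (p := 5)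
    have e1 : 2 * (5 * k + 1) % 5 = 2 := by omega
    have e2 : (5 * k + 1) % 5 = 1 := by omega
    have e3 : 2 * (5 * k + 1) / 5 = 2 * k := by omega
    have e4 : (5 * k + 1) / 5 = k := by omega
    rw [e1, e2, e3, e4, show Nat.choose 2 1 = 2 from rfl] at hL
    rw [hL.dvd_iff dvd_rfl]
    omega

variable {F : Type*} [Field F] [Fintype F] [DecidableEq F]

theorem sum_pow_eq_ite {i : ℕ} (hi : i ≠ 0) :
    ∑ x : F, x ^ i = if Fintype.card F - 1 ∣ i then -1 else 0 := by
  rw [← FiniteField.sum_pow_units F i, ← sum_erase univ (a := (0 : F)) (by simp [hi])]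
  symm
  refine sum_bij (fun u _ => (u : F)) (by simp) (fun _ _ _ _ h => Units.ext h) ?_ (by simp)
  intro x hx
  exact ⟨Units.mk0 x (by simpa using hx), mem_univ _, rfl⟩

/-- The reduction of a Jacobsthal sum modulo the characteristic (its Hasse invariant). -/
theorem jacobsthalSum_cast {k : ℕ} (hF : ringChar F ≠ 2) (hk : Fintype.card F = 4 * k + 1)
    (a : F) : (jacobsthalSum a : F) = -(a ^ k * (2 * k).choose k) := by
  have hk0 : k ≠ 0 := by
    rintro rfl
    have := Fintype.one_lt_card (α := F)
    omega
  have hhalf : Fintype.card F / 2 = 2 * k := by omega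
  have hterm : ∀ x : F, ((quadraticChar F x * quadraticChar F (x ^ 2 + a) : ℤ) : F) =
      ∑ j ∈ range (2 * k + 1), a ^ (2 * k - j) * (2 * k).choose j * x ^ (2 * k + 2 * j) := by
    intro x
    rw [Int.cast_mul, quadraticChar_eq_pow_of_char_ne_two' hF,
      quadraticChar_eq_pow_of_char_ne_two' hF, hhalf, add_pow, mul_sum]
    refine sum_congr rfl fun j _ => ?_
    rw [pow_add, pow_mul x 2 j]
    ring
  -- Power sums survive only at exponents divisible by q - 1 = 4k. As 2k + 2j runs from 2k to 6k,
  -- this forces j = k.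
  rw [jacobsthalSum, Int.cast_sum, sum_congr rfl fun x _ => hterm x, sum_comm,
    sum_eq_single k]
  · rw [← mul_sum, sum_pow_eq_ite (by omega), if_pos (by rw [hk]; exact ⟨1, by omega⟩),
      show 2 * k - k = k by omega]
    ring
  · intro j hj hjk
    rw [mem_range] at hj
    rw [← mul_sum, sum_pow_eq_ite (by omega), if_neg, mul_zero]
    rw [hk]
    rintro ⟨m, hm⟩
    rw [Nat.add_sub_cancel] at hm
    have hm1 : m < 2 := by
      by_contra! h
      have := Nat.mul_le_mul_left (4 * k) h
      omega
    interval_cases m <;> omega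
  · intro h
    exact absurd (mem_range.mpr (by omega)) h

theorem not_five_dvd_jacobsthalSum [CharP F 5] {d : ℕ} (hq : Fintype.card F = 5 ^ d) {a : F}
    (ha : a ≠ 0) : ¬ (5 : ℤ) ∣ jacobsthalSum a := by
  obtain ⟨k, hk, hch⟩ := exists_five_pow_eq_and_not_dvd_centralBinom d
  have hF : ringChar F ≠ 2 := by rw [ringChar.eq F 5]; norm_num
  intro h
  have h0 := (CharP.intCast_eq_zero_iff F 5 (jacobsthalSum a)).mpr (by exact_mod_cast h)
  rw [jacobsthalSum_cast hF (hq.trans hk), neg_eq_zero] at h0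
  exact hch ((CharP.cast_eq_zero_iff F 5 _).mp
    ((mul_eq_zero.mp h0).resolve_left (pow_ne_zero _ ha)))

end PowerSums

/-! ### Orbits of negation and inversion; the value of S mod 8. -/

section OrbitCount

variable {F : Type*} [Field F]

/-- Up to a unit the difference factors as (y² - x²)(y² - x⁻²), so this invariant separates orbits.
-/
theorem sq_add_inv_sq_eq_iff {x y : F} (hx : x ≠ 0) (hy : y ≠ 0) :
    y ^ 2 + y⁻¹ ^ 2 = x ^ 2 + x⁻¹ ^ 2 ↔ y = x ∨ y = -x ∨ y = x⁻¹ ∨ y = -x⁻¹ := by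
  constructor
  · intro h
    have h1 : (y ^ 2 - x ^ 2) * (y ^ 2 - x⁻¹ ^ 2) = 0 := by
      field_simp at h ⊢
      linear_combination h
    rcases mul_eq_zero.mp h1 with h2 | h2
    · rcases sq_eq_sq_iff_eq_or_eq_neg.mp (sub_eq_zero.mp h2) with h3 | h3 <;> simp [h3]
    · rcases sq_eq_sq_iff_eq_or_eq_neg.mp (sub_eq_zero.mp h2) with h3 | h3 <;> simp [h3]
  · rintro (rfl | rfl | rfl | rfl)
    · rfl
    · rw [inv_neg]; ring
    · rw [inv_inv]; ring
    · rw [inv_neg, inv_inv]; ring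

/-- A finite set stable under `x ↦ -x` and `x ↦ x⁻¹` on which this group acts freely. -/
theorem four_dvd_card_of_neg_mem_of_inv_mem [DecidableEq F] (h2 : (2 : F) ≠ 0) (B : Finset F)
    (h0 : ∀ x ∈ B, x ≠ 0) (h1 : ∀ x ∈ B, x ^ 2 ≠ 1) (hi : ∀ x ∈ B, x ^ 2 ≠ -1)
    (hneg : ∀ x ∈ B, -x ∈ B) (hinv : ∀ x ∈ B, x⁻¹ ∈ B) : 4 ∣ B.card := by
  rw [card_eq_sum_card_image (fun x : F => x ^ 2 + x⁻¹ ^ 2) B]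
  refine dvd_sum fun b hb => ?_
  obtain ⟨x, hx, rfl⟩ := mem_image.mp hb
  have hx0 := h0 x hx
  have hfib : {y ∈ B | y ^ 2 + y⁻¹ ^ 2 = x ^ 2 + x⁻¹ ^ 2} = {x, -x, x⁻¹, -x⁻¹} := by
    ext y
    simp only [mem_filter, mem_insert, mem_singleton]
    constructor
    · rintro ⟨hy, h⟩
      exact (sq_add_inv_sq_eq_iff hx0 (h0 y hy)).mp h
    · intro h
      have hy : y ∈ B := by
        rcases h with rfl | rfl | rfl | rfl
        exacts [hx, hneg _ hx, hinv _ hx, hneg _ (hinv _ hx)]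
      exact ⟨hy, (sq_add_inv_sq_eq_iff hx0 (h0 y hy)).mpr h⟩
  have hself : ∀ z : F, z ≠ 0 → z ≠ -z := fun z hz h => hz (by
    have : 2 * z = 0 := by linear_combination h
    exact (mul_eq_zero.mp this).resolve_left h2)
  have a1 := hself x hx0
  have a2 := hself _ (inv_ne_zero hx0)
  have a3 : x ≠ x⁻¹ := fun h => h1 x hx (by
    rw [sq]; nth_rewrite 2 [h]; exact mul_inv_cancel₀ hx0)
  have a4 : x ≠ -x⁻¹ := fun h => hi x hx (by
    rw [sq]; nth_rewrite 2 [h]; rw [mul_neg, mul_inv_cancel₀ hx0])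
  have a5 : -x ≠ x⁻¹ := fun h => a4 (by rw [← h, neg_neg])
  have a6 : -x ≠ -x⁻¹ := fun h => a3 (neg_injective h)
  have hcard : ({x, -x, x⁻¹, -x⁻¹} : Finset F).card = 4 := by
    rw [card_insert_of_notMem (by simp [a1, a3, a4]), card_insert_of_notMem (by simp [a5, a6]),
      card_pair a2]
  show 4 ∣ ({y ∈ B | y ^ 2 + y⁻¹ ^ 2 = x ^ 2 + x⁻¹ ^ 2}).card
  rw [hfib, hcard]

variable [Fintype F] [DecidableEq F]

theorem quadraticChar_neg_one_of_charP_five [CharP F 5] : quadraticChar F (-1) = 1 := by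
  have h5 : (5 : F) = 0 := by exact_mod_cast CharP.cast_eq_zero F 5
  rw [quadraticChar_one_iff_isSquare (neg_ne_zero.mpr one_ne_zero)]
  exact ⟨2, by linear_combination -h5⟩

/-- The congruence expresses that `8` divides the order of the curve `y ^ 2 = x ^ 3 - x`. -/
theorem jacobsthalSum_neg_one_modEq [CharP F 5] :
    jacobsthalSum (-1 : F) ≡ Fintype.card F - 3 [ZMOD 8] := by
  have h5 : (5 : F) = 0 := by exact_mod_cast CharP.cast_eq_zero F 5
  have hF : ringChar F ≠ 2 := by rw [ringChar.eq F 5]; norm_num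
  have h2 : (2 : F) ≠ 0 := Ring.two_ne_zero hF
  have hm1 := quadraticChar_neg_one_of_charP_five (F := F)
  have hneg : ∀ x : F, quadraticChar F (-x) = quadraticChar F x := fun x => by
    rw [← neg_one_mul, map_mul, hm1, one_mul]
  let f : F → ℤ := fun x => quadraticChar F x * quadraticChar F (x ^ 2 + -1)
  have hf : ∀ x, f x = quadraticChar F (x * (x ^ 2 + -1)) := fun x => (map_mul _ _ _).symm
  -- Since f has three zeros, S = q - 3 - 2|B|, and 4 ∣ |B| suffices. The value -1 is chosen because
  -- the points with x² = -1, where the action is not free, have f = 1.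
  let B : Finset F := univ.filter fun x => f x = -1
  have hB : ∀ x, x ∈ B ↔ f x = -1 := fun x => by simp [B]
  have hf0 : ∀ x, f x = 0 ↔ x ∈ ({0, 1, -1} : Finset F) := by
    intro x
    rw [hf, quadraticChar_eq_zero_iff, mul_eq_zero, mem_insert, mem_insert, mem_singleton,
      ← sub_eq_add_neg, sub_eq_zero, sq, mul_self_eq_one_iff]
  have hB4 : 4 ∣ B.card := by
    have hx0 : ∀ x ∈ B, x ≠ 0 := by
      rintro x hx rfl
      have := (hf0 0).mpr (by simp)
      rw [hB] at hx
      omega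
    refine four_dvd_card_of_neg_mem_of_inv_mem h2 B hx0 ?_ ?_ ?_ ?_
    · intro x hx h
      have : f x = 0 := by simp [f, h]
      rw [hB] at hx
      omega
    · intro x hx h
      have e : f x = 1 := by
        rw [hf, h]
        have e : x * (-1 + -1) = -(1 + x) ^ 2 := by linear_combination h
        rw [e, hneg, quadraticChar_sq_one']
        intro hx1
        exact h2 (by linear_combination h - (x - 1) * hx1)
      rw [hB] at hx
      omega
    · intro x hx
      rw [hB] at hx ⊢
      simp only [f, hneg, neg_sq] at hx ⊢
      exact hx
    · intro x hx
      have h0 := hx0 x hx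
      rw [hB, hf] at hx ⊢
      have e : x⁻¹ * (x⁻¹ ^ 2 + -1) = -((x⁻¹ ^ 2) ^ 2 * (x * (x ^ 2 + -1))) := by
        field_simp
        ring
      rw [e, hneg, map_mul, quadraticChar_sq_one' (pow_ne_zero _ (inv_ne_zero h0)), one_mul, hx]
  have hsplit : ∀ x, f x = 1 - 2 * (if x ∈ B then 1 else 0) -
      (if x ∈ ({0, 1, -1} : Finset F) then 1 else 0) := by
    intro x
    by_cases h : f x = 0
    · rw [if_pos ((hf0 x).mp h), if_neg (by rw [hB]; omega), h]; norm_num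
    · rw [if_neg (mt (hf0 x).mpr h)]
      rw [hf, quadraticChar_eq_zero_iff] at h
      rcases quadraticChar_dichotomy h with h' | h' <;> rw [← hf] at h'
      · rw [if_neg (by rw [hB]; omega), h']; norm_num
      · rw [if_pos ((hB x).mpr h'), h']; norm_num
  have hne : (1 : F) ≠ -1 := fun h => h2 (by linear_combination h)
  have hc : ({0, 1, -1} : Finset F).card = 3 := by
    rw [card_insert_of_notMem (by simp), card_pair hne]
  have hS : jacobsthalSum (-1 : F) = Fintype.card F - 2 * B.card - 3 := by
    have : jacobsthalSum (-1 : F) = ∑ x, f x := rfl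
    rw [this, sum_congr rfl fun x _ => hsplit x, sum_sub_distrib, sum_sub_distrib, ← mul_sum,
      sum_boole, sum_boole, filter_mem_eq_inter, univ_inter, filter_mem_eq_inter, univ_inter, hc]
    simp
  obtain ⟨m, hm⟩ := hB4
  rw [hS, hm, Int.modEq_iff_dvd]
  exact ⟨m, by push_cast; ring⟩

end OrbitCount

/-! ### Uniqueness of the normalized representation. -/

section SumsOfTwoSquares

/-- 5^d divides (sb - ta)(sb + ta), but 5 cannot divide both factors, so 5^d divides one of them. By
the Brahmagupta identity that factor is one leg in a representation of (5^d)² whose other leg is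
odd, so it vanishes. -/
theorem IsNormalizedTwoSquares.unique {d : ℕ} (hd : d ≠ 0) {s t a b : ℤ}
    (h : IsNormalizedTwoSquares 5 (5 ^ d) s t) (h' : IsNormalizedTwoSquares 5 (5 ^ d) a b) :
    s = a := by
  obtain ⟨h1, h2, h3⟩ := h
  obtain ⟨h1', h2', h3'⟩ := h'
  push_cast at h1 h1' h2 h2'
  have hp : Prime (5 : ℤ) := by norm_num
  have h5q : (5 : ℤ) ∣ 5 ^ d := dvd_pow_self _ hd
  have hb : ¬ (5 : ℤ) ∣ b := fun hb => h2' (hp.dvd_of_dvd_pow (n := 2) (by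
    have := dvd_sub h5q (hb.mul_left b)
    rwa [h1', show a ^ 2 + b ^ 2 - b * b = a ^ 2 by ring] at this))
  have hs2 : s % 4 = 1 := h3
  have ha2 : a % 4 = 1 := h3'
  have hodd : (5 : ℤ) ^ d % 2 = 1 := by
    have : (5 : ℤ) ^ d ≡ 1 ^ d [ZMOD 2] := Int.ModEq.pow d rfl
    rw [one_pow] at this
    exact this
  have even_of : ∀ u v : ℤ, u % 4 = 1 → (5 : ℤ) ^ d = u ^ 2 + v ^ 2 → Even v := by
    intro u v hu huv
    by_contra hv
    rw [Int.not_even_iff_odd] at hv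
    have hu' : Odd u := Int.odd_iff.mpr (by omega)
    have := hu'.pow (n := 2) |>.add_odd (hv.pow (n := 2))
    rw [← huv, Int.even_iff] at this
    omega
  have ht := even_of s t hs2 h1
  have hodd' : s * a + t * b ≠ 0 ∧ s * a - t * b ≠ 0 := by
    have hsa : Odd (s * a) := (Int.odd_iff.mpr (by omega)).mul (Int.odd_iff.mpr (by omega))
    have htb : Even (t * b) := ht.mul_right b
    constructor
    · intro h0
      have := hsa.add_even htb
      rw [h0] at this
      exact absurd this (by decide)
    · intro h0
      have := hsa.sub_even htb
      rw [h0] at this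
      exact absurd this (by decide)
  have hprod : (5 : ℤ) ^ d ∣ (s * b - t * a) * (s * b + t * a) :=
    ⟨s ^ 2 - a ^ 2, by linear_combination (-s ^ 2) * h1' + a ^ 2 * h1⟩
  have hpos : (0 : ℤ) < 5 ^ d := by positivity
  have hzero : ∀ u v : ℤ, (5 : ℤ) ^ d ∣ u → (5 ^ d) ^ 2 = u ^ 2 + v ^ 2 → v ≠ 0 → u = 0 := by
    intro u v hu huv hv
    by_contra hu0
    have h4 : (5 : ℤ) ^ d ≤ |u| := Int.le_of_dvd (abs_pos.mpr hu0) ((dvd_abs _ _).mpr hu)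
    have h5 : ((5 : ℤ) ^ d) ^ 2 ≤ u ^ 2 := by
      rw [← sq_abs u]
      exact pow_le_pow_left₀ hpos.le h4 2
    have h6 : 0 < v ^ 2 := by positivity
    omega
  have hmul : s * b - t * a = 0 ∨ s * b + t * a = 0 := by
    by_cases h5 : (5 : ℤ) ∣ s * b - t * a
    · have h6 : ¬ (5 : ℤ) ∣ s * b + t * a := by
        intro h6
        have h7 := dvd_add h5 h6
        rw [show s * b - t * a + (s * b + t * a) = 2 * (s * b) by ring] at h7
        rcases hp.dvd_or_dvd h7 with h8 | h8
        · norm_num at h8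
        · rcases hp.dvd_or_dvd h8 with h9 | h9
          exacts [h2 h9, hb h9]
      left
      refine hzero _ (s * a + t * b) ?_ ?_ hodd'.1
      · exact (((Prime.coprime_iff_not_dvd hp).mpr h6).pow_left).dvd_of_dvd_mul_right hprod
      · linear_combination (5 : ℤ) ^ d * h1 + (s ^ 2 + t ^ 2) * h1'
    · right
      refine hzero _ (s * a - t * b) ?_ ?_ hodd'.2
      · exact (((Prime.coprime_iff_not_dvd hp).mpr h5).pow_left).dvd_of_dvd_mul_left hprod
      · linear_combination (5 : ℤ) ^ d * h1 + (s ^ 2 + t ^ 2) * h1'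
  have hsq : (s * b) ^ 2 = (t * a) ^ 2 := by
    have : (s * b - t * a) * (s * b + t * a) = 0 := mul_eq_zero.mpr hmul
    linear_combination this
  have hsa : s ^ 2 = a ^ 2 := by
    have : (5 : ℤ) ^ d * (s ^ 2 - a ^ 2) = 0 := by
      linear_combination hsq + s ^ 2 * h1' - a ^ 2 * h1
    have := (mul_eq_zero.mp this).resolve_left hpos.ne'
    omega
  rcases sq_eq_sq_iff_eq_or_eq_neg.mp hsa with h8 | h8 <;> omega

end SumsOfTwoSquares

/-! ### Identification of S with ±2s. -/

section Normalization

variable {F : Type*} [Field F] [Fintype F] [DecidableEq F]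

theorem exists_isNormalizedTwoSquares_jacobsthalSum [CharP F 5] {d : ℕ}
    (hq : Fintype.card F = 5 ^ d) : ∃ s t : ℤ, IsNormalizedTwoSquares 5 (5 ^ d) s t ∧
      jacobsthalSum (-1 : F) = -(-1) ^ d * (2 * s) := by
  have hF : ringChar F ≠ 2 := by rw [ringChar.eq F 5]; norm_num
  have hm1 := quadraticChar_neg_one_of_charP_five (F := F)
  obtain ⟨g, hg⟩ := quadraticChar_exists_neg_one hF
  have hsum := jacobsthalSum_sq_add_sq hF hm1 hm1 hg
  have hmod := jacobsthalSum_neg_one_modEq (F := F)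
  have hdvd := not_five_dvd_jacobsthalSum hq (neg_ne_zero.mpr (one_ne_zero (α := F)))
  rw [hq] at hsum hmod
  push_cast at hsum hmod
  set S := jacobsthalSum (-1 : F)
  have hq8 : (5 : ℤ) ^ d % 8 = if Even d then 1 else 5 := by
    split_ifs with h
    · obtain ⟨k, rfl⟩ := h
      have : ((5 : ℤ) ^ 2) ^ k ≡ 1 ^ k [ZMOD 8] := Int.ModEq.pow k rfl
      rw [one_pow, ← pow_mul, two_mul] at this
      exact this
    · obtain ⟨k, rfl⟩ := Nat.not_even_iff_odd.mp h
      have : ((5 : ℤ) ^ 2) ^ k * 5 ≡ 1 ^ k * 5 [ZMOD 8] :=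
        (Int.ModEq.pow k (show (5 : ℤ) ^ 2 ≡ 1 [ZMOD 8] from rfl)).mul_right 5
      rw [one_pow, ← pow_mul, ← pow_succ] at this
      exact this
  have hmod' : S % 8 = (5 ^ d - 3) % 8 := hmod
  have hSeven : Even S := by
    rw [Int.even_iff]
    split_ifs at hq8 <;> omega
  obtain ⟨r, hr⟩ := hSeven
  have hTeven : Even (jacobsthalSum g) := by
    rw [← Int.even_pow' (n := 2) two_ne_zero, Int.even_iff]
    have : jacobsthalSum g ^ 2 = 2 * (2 * 5 ^ d - 2 * r ^ 2) := by rw [hr] at hsum; linarith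
    omega
  obtain ⟨t, ht⟩ := hTeven
  -- Mod 8, S = 2r is -2 for d even and 2 for d odd, so this sign makes the witness 1 mod 4.
  refine ⟨-(-1) ^ d * r, t, ⟨?_, ?_, ?_⟩, ?_⟩
  · have h1 : ((-1 : ℤ) ^ d) ^ 2 = 1 := by rw [← pow_mul, mul_comm, pow_mul]; norm_num
    rw [hr, ht] at hsum
    push_cast
    have h2 : (-(-1) ^ d * r) ^ 2 = r ^ 2 := by linear_combination r ^ 2 * h1
    rw [h2]
    linarith
  · intro h
    apply hdvd
    push_cast at h
    have h1 : (5 : ℤ) ∣ r := by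
      rcases neg_one_pow_eq_or ℤ d with e | e <;> rw [e] at h <;> omega
    omega
  · show _ % 4 = 1 % 4
    rcases Nat.even_or_odd d with h | h
    · rw [if_pos h] at hq8
      rw [h.neg_one_pow]
      omega
    · rw [if_neg (Nat.not_even_iff_odd.mpr h)] at hq8
      rw [h.neg_one_pow]
      omega
  · have h1 : ((-1 : ℤ) ^ d) ^ 2 = 1 := by rw [← pow_mul, mul_comm, pow_mul]; norm_num
    rw [hr]
    linear_combination (-2 * r) * h1

end Normalization

/-! ### From quadruples to character sums. -/

section Counting

theorem forall_consecutiveQuadruple_iff {F : Type*} [Field F] {p : F → Prop} {α : F} :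
    (∀ x ∈ consecutiveQuadruple α, p x) ↔ p (α - 1) ∧ p α ∧ p (α + 1) ∧ p (α + 2) := by
  simp [consecutiveQuadruple]

variable {F : Type*} [Field F] [Fintype F] [DecidableEq F]

/-- The quadratic character at the four members of the quadruple through `α`, each combined with
the sign `ε` into the factor which detects the value `ε`. -/
def quadrupleWeight (ε : ℤ) (α : F) : ℤ :=
  (1 + ε * quadraticChar F (α - 1)) * (1 + ε * quadraticChar F α) *
    (1 + ε * quadraticChar F (α + 1)) * (1 + ε * quadraticChar F (α + 2))

theorem quadraticChar_eq_one_iff {x : F} : quadraticChar F x = 1 ↔ x ≠ 0 ∧ IsSquare x := by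
  by_cases hx : x = 0
  · simp [hx]
  · rw [quadraticChar_one_iff_isSquare hx, and_iff_right hx]

theorem squareQuadrupleCount_eq :
    squareQuadrupleCount F = #{α : F | ∀ x ∈ ({α - 1, α, α + 1, α + 2} : Finset F),
      quadraticChar F x = 1} := by
  rw [squareQuadrupleCount, ← Set.ncard_coe_finset]
  congr 1
  ext α
  simp [forall_consecutiveQuadruple_iff, -quadraticChar_apply, quadraticChar_eq_one_iff]

theorem nonsquareQuadrupleCount_eq :
    nonsquareQuadrupleCount F = #{α : F | ∀ x ∈ ({α - 1, α, α + 1, α + 2} : Finset F),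
      quadraticChar F x = -1} := by
  rw [nonsquareQuadrupleCount, ← Set.ncard_coe_finset]
  congr 1
  ext α
  simp [forall_consecutiveQuadruple_iff, -quadraticChar_apply, quadraticChar_neg_one_iff_not_isSquare]

/-- A factor of a quadruple weight, away from zero. -/
theorem one_add_mul_quadraticChar {ε : ℤ} (hε : ε = 1 ∨ ε = -1) {x : F} (hx : x ≠ 0) :
    1 + ε * quadraticChar F x = if quadraticChar F x = ε then 2 else 0 := by
  rcases quadraticChar_dichotomy hx with h | h <;> rcases hε with rfl | rfl <;> rw [h] <;> norm_num

/-- At α = 1, 0, -1, -2 some member of the quadruple is 0; such α are never counted but may have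
nonzero weight, hence the correction. -/
theorem sixteen_mul_card_eq {ε : ℤ} (hε : ε = 1 ∨ ε = -1) :
    16 * ((#{α : F | ∀ x ∈ ({α - 1, α, α + 1, α + 2} : Finset F),
      quadraticChar F x = ε} : ℕ) : ℤ) =
      ∑ α : F, quadrupleWeight ε α - ∑ α ∈ ({1, 0, -1, -2} : Finset F), quadrupleWeight ε α := by
  have hε0 : (0 : ℤ) ≠ ε := by rcases hε with rfl | rfl <;> norm_num
  have key : ∀ α : F,
      16 * (if ∀ x ∈ ({α - 1, α, α + 1, α + 2} : Finset F), quadraticChar F x = ε then 1 else 0) =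
      quadrupleWeight ε α -
        if α ∈ ({1, 0, -1, -2} : Finset F) then quadrupleWeight ε α else 0 := by
    intro α
    by_cases hα : α ∈ ({1, 0, -1, -2} : Finset F)
    · rw [if_pos hα, sub_self, if_neg, mul_zero]
      intro h
      simp only [mem_insert, mem_singleton, forall_eq_or_imp, forall_eq] at hα h
      obtain ⟨h1, h2, h3, h4⟩ := h
      rcases hα with rfl | rfl | rfl | rfl
      · exact hε0 (by simpa using h1)
      · exact hε0 (by simpa using h2)
      · exact hε0 (by simpa using h3)
      · exact hε0 (by simpa using h4)
    · rw [if_neg hα, sub_zero]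
      simp only [mem_insert, mem_singleton, forall_eq_or_imp, forall_eq, not_or] at hα ⊢
      obtain ⟨h1, h2, h3, h4⟩ := hα
      rw [quadrupleWeight, one_add_mul_quadraticChar hε (sub_ne_zero.mpr h1),
        one_add_mul_quadraticChar hε h2,
        one_add_mul_quadraticChar hε (fun h => h3 (eq_neg_of_add_eq_zero_left h)),
        one_add_mul_quadraticChar hε (fun h => h4 (eq_neg_of_add_eq_zero_left h))]
      split_ifs <;> simp_all
  have := sum_congr (rfl : (univ : Finset F) = univ) fun α _ => key α
  rw [sum_sub_distrib, ← mul_sum, sum_boole, sum_ite_mem, univ_inter] at this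
  exact this

theorem sum_quadraticChar_comp_add (hF : ringChar F ≠ 2) (v : F) :
    ∑ x, quadraticChar F (x + v) = 0 := by
  rw [← quadraticChar_sum_zero hF]
  exact Equiv.sum_comp (Equiv.addRight v) fun x => quadraticChar F x

theorem jacobsthalSum_neg_one_eq :
    jacobsthalSum (-1 : F) =
      ∑ x, quadraticChar F (x - 1) * quadraticChar F x * quadraticChar F (x + 1) := by
  refine sum_congr rfl fun x _ => ?_
  rw [show x ^ 2 + -1 = (x - 1) * (x + 1) by ring, map_mul]
  ring

/-- A product of three translates of the quadratic character whose zeros are taken to `1, 0, -1`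
by an affine map has a Jacobsthal sum as its sum. -/
theorem sum_eq_mul_jacobsthalSum (f : F → ℤ) {u : F} (hu : u ≠ 0) (v : F) (c : ℤ)
    (h : ∀ x, f (u * x + v) = c * quadraticChar F ((x - 1) * x * (x + 1))) :
    ∑ x, f x = c * jacobsthalSum (-1 : F) := by
  rw [← sum_comp_affine f hu v, jacobsthalSum_neg_one_eq, mul_sum]
  refine sum_congr rfl fun x _ => ?_
  rw [h, map_mul, map_mul]

theorem quadraticChar_mul_sq (a : F) {b : F} (hb : b ≠ 0) :
    quadraticChar F (a * b ^ 2) = quadraticChar F a := by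
  rw [map_mul, quadraticChar_sq_one' hb, mul_one]

/-- Inversion sends the root 0 to infinity and leaves a cubic with roots 1, -1, 2, the image of 1,
0, -1 under x ↦ 2x - 1. -/
theorem sum_quadraticChar_quartic [CharP F 5] :
    ∑ x : F, quadraticChar F (x - 1) * quadraticChar F x * quadraticChar F (x + 1) *
      quadraticChar F (x + 2) = jacobsthalSum (-1 : F) - 1 := by
  have h5 : (5 : F) = 0 := by exact_mod_cast CharP.cast_eq_zero F 5
  have h2 : (2 : F) ≠ 0 := Ring.two_ne_zero (by rw [ringChar.eq F 5]; norm_num)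
  have hm1 := quadraticChar_neg_one_of_charP_five (F := F)
  let h : F → ℤ := fun u => quadraticChar F ((1 - u) * (1 + u) * (1 + 2 * u))
  -- With 0⁻¹ = 0 the left side vanishes at u = 0 whereas h 0 = 1; this produces the -1.
  have hinv : ∀ u : F, quadraticChar F (u⁻¹ - 1) * quadraticChar F u⁻¹ *
      quadraticChar F (u⁻¹ + 1) * quadraticChar F (u⁻¹ + 2) = h u - if u = 0 then 1 else 0 := by
    intro u
    by_cases hu : u = 0
    · simp [hu, h]
    · rw [if_neg hu, sub_zero, ← map_mul, ← map_mul, ← map_mul,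
        ← quadraticChar_mul_sq _ (pow_ne_zero 2 hu)]
      simp only [h]
      congr 1
      field_simp
  rw [← Equiv.sum_comp (Equiv.inv F)]
  simp only [Equiv.inv_apply]
  rw [sum_congr rfl fun u _ => hinv u, sum_sub_distrib, sum_eq_mul_jacobsthalSum h h2 (-1) 1]
  · simp
  · intro x
    simp only [h]
    have e : (1 - (2 * x + -1)) * (1 + (2 * x + -1)) * (1 + 2 * (2 * x + -1)) =
        -1 * ((x - 1) * x * (x + 1) * (2 ^ 2) ^ 2) := by
      linear_combination (4 * (x - 1) * x) * h5
    rw [e, map_mul, hm1, quadraticChar_mul_sq _ (pow_ne_zero 2 h2)]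

/-- The -7 collects six pair sums and the -1 of the quartic. Modulo 5 each triple of roots is an
arithmetic progression; those of difference 2 contribute χ(2³) = χ(2). -/
theorem sum_quadrupleWeight [CharP F 5] (ε : ℤ) (hε : ε = 1 ∨ ε = -1) :
    ∑ α : F, quadrupleWeight ε α = Fintype.card F - 7 +
      (2 * ε * (1 + quadraticChar F 2) + 1) * jacobsthalSum (-1 : F) := by
  have h5 : (5 : F) = 0 := by exact_mod_cast CharP.cast_eq_zero F 5
  have hF : ringChar F ≠ 2 := by rw [ringChar.eq F 5]; norm_num
  have h2 : (2 : F) ≠ 0 := Ring.two_ne_zero hF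
  have h1 : (1 : F) ≠ 0 := one_ne_zero
  have h3 : (3 : F) ≠ 0 := fun h => h1 (by linear_combination 2 * h - h5)
  have hexp : ∀ x : F, quadrupleWeight ε x = 1 +
      ε * (quadraticChar F (x + -1) + quadraticChar F (x + 0) + quadraticChar F (x + 1) +
        quadraticChar F (x + 2)) +
      (quadraticChar F (x + -1) * quadraticChar F (x + 0) +
        quadraticChar F (x + -1) * quadraticChar F (x + 1) +
        quadraticChar F (x + -1) * quadraticChar F (x + 2) +
        quadraticChar F (x + 0) * quadraticChar F (x + 1) +
        quadraticChar F (x + 0) * quadraticChar F (x + 2) +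
        quadraticChar F (x + 1) * quadraticChar F (x + 2)) +
      ε * (quadraticChar F ((x - 1) * x * (x + 1)) + quadraticChar F ((x - 1) * x * (x + 2)) +
        quadraticChar F ((x - 1) * (x + 1) * (x + 2)) + quadraticChar F (x * (x + 1) * (x + 2))) +
      quadraticChar F (x - 1) * quadraticChar F x * quadraticChar F (x + 1) *
        quadraticChar F (x + 2) := by
    intro x
    rw [quadrupleWeight, add_zero, ← sub_eq_add_neg]
    simp only [map_mul]
    rcases hε with rfl | rfl <;> ring
  have t1 : ∑ x : F, quadraticChar F ((x - 1) * x * (x + 1)) = 1 * jacobsthalSum (-1 : F) :=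
    sum_eq_mul_jacobsthalSum _ h1 0 _ fun x => by rw [one_mul, one_mul, add_zero]
  have t2 : ∑ x : F, quadraticChar F ((x - 1) * x * (x + 2)) =
      quadraticChar F 2 * jacobsthalSum (-1 : F) :=
    -- x ↦ 2x + 3 carries 1, 0, -1 to 0, -2, 1 in characteristic 5.
    sum_eq_mul_jacobsthalSum _ h2 3 _ fun x => by
      rw [← map_mul, ← quadraticChar_mul_sq (2 * _) h2]
      congr 1
      linear_combination (8 * x ^ 2 + 14 * x + 6) * h5
  have t3 : ∑ x : F, quadraticChar F ((x - 1) * (x + 1) * (x + 2)) =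
      quadraticChar F 2 * jacobsthalSum (-1 : F) :=
    sum_eq_mul_jacobsthalSum _ h2 1 _ fun x => by
      rw [← map_mul, ← quadraticChar_mul_sq (2 * _) h2]
      congr 1
      linear_combination (4 * x ^ 2 + 4 * x) * h5
  have t4 : ∑ x : F, quadraticChar F (x * (x + 1) * (x + 2)) = 1 * jacobsthalSum (-1 : F) :=
    sum_eq_mul_jacobsthalSum _ h1 (-1) _ fun x => by
      rw [one_mul, one_mul]
      congr 1
      ring
  have pair := fun {u v : F} (huv : u - v ≠ 0) => sum_quadraticChar_mul_add hF (sub_ne_zero.mp huv)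
  rw [sum_congr rfl fun x _ => hexp x]
  simp only [sum_add_distrib, ← mul_sum, sum_quadraticChar_comp_add hF, t1, t2, t3, t4,
    sum_quadraticChar_quartic]
  rw [pair (u := -1) (v := 0) (by simp), pair (u := -1) (v := 1) (by ring_nf; simpa using h2),
    pair (u := -1) (v := 2) (by ring_nf; simpa using h3), pair (u := 0) (v := 1) (by simp),
    pair (u := 0) (v := 2) (by simpa using h2), pair (u := 1) (v := 2) (by ring_nf; simp)]
  simp
  ring

/-- All nonzero arguments are ±1 or ±2 modulo 5, and χ(-1) = 1, so only χ(2) is left. -/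
theorem sum_quadrupleWeight_degenerate [CharP F 5] (ε : ℤ) :
    ∑ α ∈ ({1, 0, -1, -2} : Finset F), quadrupleWeight ε α =
      2 * (1 + ε) * (1 + ε * quadraticChar F 2) * (2 + ε + ε * quadraticChar F 2) := by
  have h5 : (5 : F) = 0 := by exact_mod_cast CharP.cast_eq_zero F 5
  have h1 : (1 : F) ≠ 0 := one_ne_zero
  have h2 : (2 : F) ≠ 0 := Ring.two_ne_zero (by rw [ringChar.eq F 5]; norm_num)
  have h3 : (3 : F) ≠ 0 := fun h => h1 (by linear_combination 2 * h - h5)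
  have hm1 := quadraticChar_neg_one_of_charP_five (F := F)
  have c2 : quadraticChar F (-2) = quadraticChar F 2 := by
    rw [← neg_one_mul, map_mul, hm1, one_mul]
  have c3 : quadraticChar F 3 = quadraticChar F 2 := by
    rw [← c2]; congr 1; linear_combination h5
  have c3' : quadraticChar F (-3) = quadraticChar F 2 := by
    congr 1; linear_combination -h5
  rw [sum_insert, sum_insert, sum_insert, sum_singleton]
  · simp only [quadrupleWeight]
    rw [show (1 : F) - 1 = 0 by ring, show (1 : F) + 1 = 2 by ring, show (1 : F) + 2 = 3 by ring,
      show (0 : F) - 1 = -1 by ring, show (0 : F) + 1 = 1 by ring, show (0 : F) + 2 = 2 by ring,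
      show (-1 : F) - 1 = -2 by ring, show (-1 : F) + 1 = 0 by ring,
      show (-1 : F) + 2 = 1 by ring, show (-2 : F) - 1 = -3 by ring,
      show (-2 : F) + 1 = -1 by ring, show (-2 : F) + 2 = 0 by ring, c2, c3, c3', hm1, map_one,
      quadraticChar_zero]
    ring
  · rw [mem_singleton]
    exact fun h => h1 (by linear_combination h)
  · simp [h2, eq_comm]
  · simp only [mem_insert, mem_singleton, not_or]
    exact ⟨h1, fun h => h2 (by linear_combination h), fun h => h3 (by linear_combination h)⟩

/-- 5^d is 1 or 5 mod 8 according to the parity of d, and 2 is a square in the first case only. -/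
theorem quadraticChar_two_of_card_eq {d : ℕ} (hF : Fintype.card F = 5 ^ d) [CharP F 5] :
    quadraticChar F 2 = (-1) ^ d := by
  have h2 : (2 : F) ≠ 0 := Ring.two_ne_zero (by rw [ringChar.eq F 5]; norm_num)
  have hsq : ((5 : ℕ) ^ 2) ^ (d / 2) ≡ 1 ^ (d / 2) [MOD 8] := Nat.ModEq.pow _ rfl
  rw [one_pow, ← pow_mul] at hsq
  rcases Nat.even_or_odd d with h | h
  · rw [h.neg_one_pow, quadraticChar_one_iff_isSquare h2, FiniteField.isSquare_two_iff, hF]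
    rw [Nat.two_mul_div_two_of_even h] at hsq
    have : 5 ^ d % 8 = 1 := hsq
    omega
  · rw [h.neg_one_pow, quadraticChar_neg_one_iff_not_isSquare, FiniteField.isSquare_two_iff, hF]
    have : 5 ^ (2 * (d / 2)) % 8 = 1 := hsq
    rw [← Nat.two_mul_div_two_add_one_of_odd h, pow_succ]
    omega

end Counting

theorem theorem1p2 (F : Type*) [Field F] [Fintype F] (d q : ℕ) (hq : q = 5 ^ d)
    (hF : Fintype.card F = q) :
    (∃! s : ℤ, ∃ t : ℤ, IsNormalizedTwoSquares 5 q s t) ∧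
    ∀ s t : ℤ, IsNormalizedTwoSquares 5 q s t →
      (Even d →
        (squareQuadrupleCount F : ℚ) = ((q : ℚ) - 10 * (s : ℚ) - 39) / 16 ∧
        (nonsquareQuadrupleCount F : ℚ) = ((q : ℚ) + 6 * (s : ℚ) - 7) / 16) ∧
      (Odd d →
        (squareQuadrupleCount F : ℚ) = ((q : ℚ) + 2 * (s : ℚ) - 7) / 16 ∧
        (nonsquareQuadrupleCount F : ℚ) = ((q : ℚ) + 2 * (s : ℚ) - 7) / 16) := by
  classical
  subst hq
  have : Fact (Nat.Prime 5) := ⟨by norm_num⟩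
  have hd : d ≠ 0 := by
    rintro rfl
    have := Fintype.one_lt_card (α := F)
    omega
  have : CharP F 5 := charP_of_card_eq_prime_pow hF
  obtain ⟨s₀, t₀, h₀, hS⟩ := exists_isNormalizedTwoSquares_jacobsthalSum hF
  refine ⟨⟨s₀, ⟨t₀, h₀⟩, fun s ⟨t, h⟩ => h.unique hd h₀⟩, fun s t h => ?_⟩
  obtain rfl : s = s₀ := h.unique hd h₀
  have hm := sixteen_mul_card_eq (F := F) (ε := 1) (Or.inl rfl)
  have hn := sixteen_mul_card_eq (F := F) (ε := -1) (Or.inr rfl)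
  rw [← squareQuadrupleCount_eq, sum_quadrupleWeight 1 (Or.inl rfl),
    sum_quadrupleWeight_degenerate, quadraticChar_two_of_card_eq hF, hS, hF] at hm
  rw [← nonsquareQuadrupleCount_eq, sum_quadrupleWeight (-1) (Or.inr rfl),
    sum_quadrupleWeight_degenerate, quadraticChar_two_of_card_eq hF, hS, hF] at hn
  have hm' := congrArg (Int.cast : ℤ → ℚ) hm
  have hn' := congrArg (Int.cast : ℤ → ℚ) hn
  push_cast at hm' hn' ⊢
  constructor
  · intro he
    rw [he.neg_one_pow] at hm' hn'
    constructor <;> linarith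
  · intro ho
    rw [ho.neg_one_pow] at hm' hn'
    constructor <;> linarith
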